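/- Let $N\le m$ be positive integers. An $N\times m$ (two-symbol) supersaturated design (SSD) is an $N\times m$ matrix $\mathbf D$ with entries $\pm1$ such that $+1$ and $-1$ occur equally often in each column and no two distinct columns satisfy $\mathbf d_i=\mathbf d_j$ or $\mathbf d_i=-\mathbf d_j$. Let $s_{ij}$ be the $(i,j)$ entry of $\mathbf D^{\top}\mathbf D$, and put $$\mathrm E(s^2)=\binom m2^{-1}\sum_{i<j}s_{ij}^2,\qquad s_{\max}=\max_{i<j}|s_{ij}|,\qquad f_{s_{\max}}=\#\{(i,j): i<j,\ |s_{ij}|=s_{\max}\}.$$ An SSD is $\mathrm E(s^2)$-optimal if no SSD of the same size has a smaller $\mathrm E(s^2)$. It is minimax-optimal if no SSD of the same size has a smaller $s_{\max}$, or the same $s_{\max}$ and a smaller $f_{s_{\max}}$. For even $N$ and $m>N-1$, let $q$ be a nonnegative integer with $-2N+2<m-q(N-1)<2N-2$ and $m+q\equiv2\pmod 4$. Put $g=(m+q)^2N-q^2N^2-mN^2$ and $a=|m-q(N-1)|$. The Ryan–Bulutoglu bound $b(N,m)$ is defined as follows. If $N\equiv0\pmod4$, then $$m(m-1)\,b(N,m)=\begin{cases}g+2N^2-4N,&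 a<N-1,\\ g-2N^2+4N+4Na,& N-1<a\le\frac32N-2,\\ g+4N^2-4N,& a>\frac32N-2.\end{cases}$$ If $N\equiv2\pmod4$, then $$m(m-1)\,b(N,m)=4m(m-1)+64\max\bigl\{0,\lceil m(m-1)(h-4)/64\rceil\bigr\},$$ where, for even $q$, $$m(m-1)\,h=\begin{cases}g+2N^2-4N+8,& a<N-1,\\ g-2N^2+20N+(4N-8)a-24,& N-1<a\le\frac32N-3,\\ g+4N^2-4N,& a>\frac32N-3,\end{cases}$$ and, for odd $q$, $$m(m-1)\,h=\begin{cases}g+2N^2-4N,& a<N-1,\\ g-2N^2+4N+4Na,& N-1<a\le\frac32N-1,\\ g+4N^2-12N+8a+8,& a>\frac32N-1.\end{cases}$$ **Theorem.** For each pair $(N,m)$ in the table, exactly one nonnegative integer $q$ satisfies the two conditions above. The $N\times m$ matrix $\mathbf D$ listed for $(N,m)$ below the table is an SSD with the tabulated values of $s_{\max}$, $f_{s_{\max}}$ and $\mathrm E(s^2)$. It attains the Ryan–Bulutoglu bound, $\mathrm E(s^2)=b(N,m)$, and it is both $\mathrm E(s^2)$-optimal and minimax-optimal. $$\begin{array}{ccccc}N&m&s_{\max}&f_{s_{\max}}&\mathrm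 E(s^2)\\ \hline 16&25&4&144&192/25\\ 16&26&4&160&512/65\\ 16&27&4&184&2944/351\\ 18&23&6&17&1556/253\\ 18&24&6&23&20/3\\ 18&25&6&30&36/5\\ 18&26&6&37&2484/325\\ 18&27&6&45&316/39\\ 18&28&6&53&1604/189\\ 18&29&6&60&1772/203\\ 20&21&4&50&80/21\\ 22&22&2&231&4\\ 22&23&2&253&4\\ 24&24&4&36&48/23\\ 24&25&4&72&96/25 \end{array}$$ The matrices are listed row by row. Each row is a word of $m$ digits, in which the digit $1$ stands for the entry $+1$ and the digit $0$ for the entry $-1$. $(N,m)=(16,25)$: 0100001010110101111000001, 1010001001000100101011010, 0111100010001010110011011, 1010111011110011011111111, 0101011011001011001010100, 1101000101100001100111101, 0100010101010110010001111, 0010001111111010000101000, 1000010100001011101100011, 0111011100111100111110110, 1001100111111100001010011, 1011100001011111110000100, 0000110010100110100110100, 0011110100100001011001000, 1100101110001101010101110, 1111111000010000000100001. $(N,m)=(16,26)$: 10000000010001101100000110, 10110010101110001101110010, 01111101111011000101001110, 11011101010100100101110001, 10101111111000010110000000, 00010010001001000111011001, 01000001111000011011110111, 01111001000101011000010000, 10011110010010011000011111,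 11110011011111111110101101, 01100110110111100010010011, 00011011100100100010101110, 00001100100111011111100101, 11100110100001110001111100, 00100101001010101000101001, 11001000001110110011001010. $(N,m)=(16,27)$: 000101011100100110010010100, 011010010001000110110101110, 110111100111010011010110010, 000010111110101111101100010, 000001100001111001000001110, 010000110101000000001010001, 011111010010101001110000001, 101100010100011101011101000, 101010001001011111000010001, 101011101000000000111011010, 110101011001111010101111011, 110000111010110101110111101, 111101101111001100100100100, 111001000110100111001001111, 000110001010010000001100111, 001110100111111010111011101. $(N,m)=(18,23)$: 01101001010011110111110, 00001010110101010110001, 10100110010010011010100, 01000010111110101011111, 10111101111100100011101, 00011111000011100000101, 01010001011101011000100, 01110100100111101110000, 11011010100000111101100, 11101111011100111100011, 11101000000110000001001, 11110011101011010010011, 10010000011010100100010, 10011100001111011111111, 00100001100000001100111, 10000101100101110001010, 00111110111001001001010, 01000111001000000111000. $(N,m)=(18,24)$: 101101001100001111000101, 000000011111101100110001, 101001110001000101100010, 011111000110001001111000, 011110010100110101010111, 010000110111011111001100, 111010101101100110111100, 100110111010100011010000, 000011101111010011110111, 101010000011101001001111, 111001010010111010110110, 110111100001011100010001, 100000000100010000011010,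 010011011010000110001011, 010100101000001000100110, 110101011001110001101101, 001100100010110110101001, 001111111101111010001010. $(N,m)=(18,25)$: 1101100011101100100001000, 1011011000001010000011101, 1001010101001111111111011, 1011001111110100110000111, 1000100100010110000111110, 1110010111011001010101100, 0001110110111010111010100, 0110010101100010001000010, 0101111011010010101101111, 0010111011000100011110000, 0101001001110011010110000, 0000001010101111011001110, 0111100110000001010011011, 0110001100111100101111001, 1101111100100101001100101, 0010100001101001100110111, 1110111000011111110000010, 1000000010010001101000001. $(N,m)=(18,26)$: 11001000000110111110100000, 00111111000110110110011001, 01011100111100001100111011, 11101101010001000100110101, 11010011011111110101111110, 01011101101000110011100100, 10100110111010100000110000, 01000011100000000111010010, 10010000101011000110001101, 01101011101111101000000111, 10111011011010001011100011, 00100001110101010010101010, 00111000110011111101010110, 10010100000101100001000011, 11110010100100011001111101, 01100110011001111111001001, 00000101010110001001001100, 10001110001001011010011110. $(N,m)=(18,27)$: 100010111001110110111010010, 111010100111001101000110010, 010101100001111111100110101, 001111000101101101111001011, 011000000011100010001011000, 001011110010110001011100001, 100001010101000001010010100, 101001011011011011101101110, 100010001010101000100000101, 110001100100010100001001111, 100100101110111011010011011,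 010111011010010101100011000, 110110110100100011101101100, 011111101000001010010000110, 011000111101011000110101001, 000110010011000110010101111, 001100011100111100001110110, 111101001110000110111110001. $(N,m)=(18,28)$: 0101001101001110110001011111, 1110110000110110111100001111, 0001101100111011011100010010, 1001010000001001100101000101, 1010101011001001111001101010, 1101111010111100110011110001, 0100000110111001101010101111, 0011001010000100011010000100, 0100110001010001011011011100, 1010011100011110001111111100, 1110010111101101010110010010, 0011110101101010010010101001, 0010100110010111100001010001, 0110001000100000100100111000, 1111011011010011000000110111, 0000111111100100001101100111, 1001000011110010000111001010, 1101100101000111101110100000. $(N,m)=(18,29)$: 10110110000001110000011110001, 01010000111000011000000010000, 00001010010110100101010100000, 10011010010100010011101011111, 01111111010010011100101101010, 10000101111110110110111010010, 11101011111111111000011001101, 11000010001010001110110111101, 01010101110011100001110111111, 10001001100011011011000100011, 11110001000101111111110001000, 00101100011101101010100111011, 00100011100000100010000001110, 11100001011101000101001110110, 11111100100110000100100000101, 00111101001010001011011010100, 01001110101001110111101100100, 00010110101101001101011001011. $(N,m)=(20,21)$: 101001110101101000111, 000110010111001010000, 101111101011011110101, 001010111110000101001, 010000111011101111110, 111001000110100110100,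 000111100001100101100, 111110010000001101111, 111100110011110011001, 001001000010011001010, 100111011110110011110, 110101101100001011000, 110011001011000000011, 011101111101010100010, 011010001101111001100, 010011110000010010101, 001100001000100010011, 010110100110111100011, 100000011000111100000, 100000000101010111111. $(N,m)=(22,22)$: 0110100011001011011011, 0100000110110110010011, 1100001001011000100010, 0010110001111100100111, 1010001110000001000111, 1010010101000010110100, 1111010100111011100011, 0001100100011001010100, 1100011101101101011001, 0000111010101010000000, 0001010111000000101001, 1101111000000100010111, 0111000000100100001100, 1110101110011110101101, 0001001011101111110101, 1011100110101100111010, 0101101101100011101110, 1100110010110001111100, 1001010011011111001110, 1011101001110010011001, 0010011000010111111010, 0111111111010101000000. $(N,m)=(22,23)$: 01110101101101101101011, 11110011011001001000100, 01101011001010110100111, 00000000001110001101100, 00100111111010110011000, 01011110111110011000001, 11000011010100111111001, 11110000010110110001010, 00111100001001010110000, 10001010101001111001010, 01000101100000011010110, 01011110010011101111110, 00110000110101110110100, 10101100011100101010111, 10101101110011011101101, 00011001010000000001011, 01101010100101000011101, 10010111001111010011111, 11001001111111000110010, 10011111100100100100100, 11000100000011100000001, 10110010100010001110011. $(N,m)=(24,24)$: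 011110110101011101101111, 110100111000010010000101, 000010111110000101010100, 011100000111100000100100, 111001010001001101000000, 100100001011010101111001, 011001111010110001101010, 111001101101100100011111, 101111100010011000011100, 111010011110001010111001, 001100101000001110110010, 011011000000110111110101, 000010000000000000001011, 010000100101111011011000, 001111011101110110001000, 100101010100000011111110, 001001001111011011000111, 000001110011101110101101, 110011100111010110100010, 010101010110111100010011, 100111101100101001100001, 101110110011100011010011, 100010011001111000110110, 110110001010101111001110. $(N,m)=(24,25)$: 0010110011011010000100001, 0000111111110101111110011, 0111101000011111011101111, 1110110101000010011011111, 0010011101001111110000100, 1010001011100001100101111, 1001010010111011111011101, 1101011110010110000000111, 1100110000110100110101100, 0100111010001000101001010, 1011100010100110111000010, 0111001110010010110111000, 0111010100100001001100001, 1111011001111001010010010, 0010000100111100100011011, 0001010001000111000111010, 0110000011010101001010100, 1000001000001100011110001, 1011111111101100001111100, 1001000101011000101100110, 0100100110101011010110110, 1000101100110011001001000, 1101100111001101110001001, 0101101001100010100010101. -/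

import Mathlib

/-- The Gram matrix `DᵀD`, whose `(i, j)` entry is `s_ij`. -/
def gram {N m : ℕ} (D : Matrix (Fin N) (Fin m) ℤ) : Matrix (Fin m) (Fin m) ℤ :=
  D.transpose * D

/-- The pairs of column indices `i < j`. -/
def columnPairs (m : ℕ) : Finset (Fin m × Fin m) :=
  Finset.univ.filter fun p => p.1 < p.2

/-- Two-symbol supersaturated design with `N` rows and `m` columns: `N ≤ m`, all entries are `±1`,
every column contains `1` and `-1` equally often, and no two columns agree up to sign. -/
structure IsSSD {N m : ℕ} (D : Matrix (Fin N) (Fin m) ℤ) : Prop where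
  rows_le_cols : N ≤ m
  entries : ∀ i j, D i j = 1 ∨ D i j = -1
  balanced : ∀ j, (Finset.univ.filter fun i => D i j = 1).card =
    (Finset.univ.filter fun i => D i j = -1).card
  col_ne : ∀ j k, j ≠ k → D.col j ≠ D.col k
  col_ne_neg : ∀ j k, j ≠ k → D.col j ≠ -D.col k

/-- `E(s²)`, the average of `s_ij²` over `i < j`. -/
def Es2 {N m : ℕ} (D : Matrix (Fin N) (Fin m) ℤ) : ℚ :=
  ∑ p ∈ columnPairs m, (gram D p.1 p.2 : ℚ) ^ 2 / (m.choose 2 : ℚ)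

/-- `s_max`, the maximum of `|s_ij|` over `i < j`. -/
def sMax {N m : ℕ} (D : Matrix (Fin N) (Fin m) ℤ) : ℕ :=
  (columnPairs m).sup fun p => (gram D p.1 p.2).natAbs

/-- The number of pairs `i < j` with `|s_ij| = s_max`. -/
def freqSMax {N m : ℕ} (D : Matrix (Fin N) (Fin m) ℤ) : ℕ :=
  ((columnPairs m).filter fun p => (gram D p.1 p.2).natAbs = sMax D).card

/-- No SSD of the same size has a smaller `E(s²)`. -/
def IsEs2Optimal {N m : ℕ} (D : Matrix (Fin N) (Fin m) ℤ) : Prop :=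
  IsSSD D ∧ ∀ D' : Matrix (Fin N) (Fin m) ℤ, IsSSD D' → ¬ Es2 D' < Es2 D

/-- No SSD of the same size has a smaller `s_max`, or the same `s_max` with a smaller frequency. -/
def IsMinimaxOptimal {N m : ℕ} (D : Matrix (Fin N) (Fin m) ℤ) : Prop :=
  IsSSD D ∧ ∀ D' : Matrix (Fin N) (Fin m) ℤ, IsSSD D' →
    ¬ (sMax D' < sMax D ∨ (sMax D' = sMax D ∧ freqSMax D' < freqSMax D))

/-- The condition that singles out the integer `q` in the Ryan–Bulutoglu bound. -/
def IsRBIndex (N m q : ℕ) : Prop :=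
  -2 * (N : ℤ) + 2 < (m : ℤ) - q * ((N : ℤ) - 1) ∧
    (m : ℤ) - q * ((N : ℤ) - 1) < 2 * (N : ℤ) - 2 ∧ (m + q) % 4 = 2

/-- `g = (m + q)² N - q² N² - m N²`. -/
def rbG (N m q : ℕ) : ℚ :=
  ((m : ℚ) + q) ^ 2 * N - (q : ℚ) ^ 2 * (N : ℚ) ^ 2 - (m : ℚ) * (N : ℚ) ^ 2

/-- `|m - q (N - 1)|`. For even `N` and `m + q ≡ 2 (mod 4)` it differs from `N - 1`, by parity, so
that the three ranges distinguished below are exhaustive. -/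
def rbDist (N m q : ℕ) : ℚ :=
  |(m : ℚ) - q * ((N : ℚ) - 1)|

/-- The Ryan–Bulutoglu bound for `N ≡ 0 (mod 4)`. -/
def rbBoundZero (N m q : ℕ) : ℚ :=
  if rbDist N m q < N - 1 then
    (rbG N m q + 2 * N ^ 2 - 4 * N) / (m * (m - 1))
  else if rbDist N m q ≤ 3 / 2 * N - 2 then
    (rbG N m q - 2 * N ^ 2 + 4 * N + 4 * N * rbDist N m q) / (m * (m - 1))
  else
    (rbG N m q + 4 * N ^ 2 - 4 * N) / (m * (m - 1))

/-- The quantity `h` in the case `N ≡ 2 (mod 4)`, for even and for odd `q`. -/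
def rbH (N m q : ℕ) : ℚ :=
  if q % 2 = 0 then
    if rbDist N m q < N - 1 then
      (rbG N m q + 2 * N ^ 2 - 4 * N + 8) / (m * (m - 1))
    else if rbDist N m q ≤ 3 / 2 * N - 3 then
      (rbG N m q - 2 * N ^ 2 + 20 * N + (4 * N - 8) * rbDist N m q - 24) / (m * (m - 1))
    else
      (rbG N m q + 4 * N ^ 2 - 4 * N) / (m * (m - 1))
  else
    if rbDist N m q < N - 1 then
      (rbG N m q + 2 * N ^ 2 - 4 * N) / (m * (m - 1))
    else if rbDist N m q ≤ 3 / 2 * N - 1 then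
      (rbG N m q - 2 * N ^ 2 + 4 * N + 4 * N * rbDist N m q) / (m * (m - 1))
    else
      (rbG N m q + 4 * N ^ 2 - 12 * N + 8 * rbDist N m q + 8) / (m * (m - 1))

/-- The Ryan–Bulutoglu bound for `N ≡ 2 (mod 4)`. -/
def rbBoundTwo (N m q : ℕ) : ℚ :=
  (4 * m * (m - 1) + 64 * (max 0 ⌈(m : ℚ) * (m - 1) * (rbH N m q - 4) / 64⌉ : ℤ)) / (m * (m - 1))

/-- The Ryan–Bulutoglu lower bound on `E(s²)` for even `N`, as a function of `N`, `m` and `q`. -/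
def rbBound (N m q : ℕ) : ℚ :=
  if N % 4 = 0 then rbBoundZero N m q else rbBoundTwo N m q

/-- `E(s²)` equals the Ryan–Bulutoglu lower bound; the index `q` of the bound is unique. -/
def AttainsRBBound {N m : ℕ} (D : Matrix (Fin N) (Fin m) ℤ) : Prop :=
  ∃ q : ℕ, (∀ q' : ℕ, IsRBIndex N m q' ↔ q' = q) ∧ Es2 D = rbBound N m q

/-- `D` is an SSD with `s_max = s`, frequency `f` of `s_max`, and `E(s²) = e`; it attains the
Ryan–Bulutoglu bound, and it is both `E(s²)`-optimal and minimax-optimal. -/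
structure IsOptimalDesign {N m : ℕ} (D : Matrix (Fin N) (Fin m) ℤ) (s f : ℕ) (e : ℚ) : Prop where
  isSSD : IsSSD D
  sMax_eq : sMax D = s
  freqSMax_eq : freqSMax D = f
  es2_eq : Es2 D = e
  attains : AttainsRBBound D
  es2Optimal : IsEs2Optimal D
  minimaxOptimal : IsMinimaxOptimal D

/-- The `±1` matrix whose `i`-th row is spelled by the `m` binary digits of the `i`-th number in
`rows`, read from left to right: the digit `1` stands for the entry `1`, `0` for the entry `-1`. -/
def signMatrix (N m : ℕ) (rows : List ℕ) : Matrix (Fin N) (Fin m) ℤ :=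
  Matrix.of fun i j => if (rows.getD i 0).testBit (j.rev : ℕ) then 1 else -1

/-- The design with 16 rows and 25 columns. -/
def design_16_25 : Matrix (Fin 16) (Fin 25) ℤ :=
  signMatrix 16 25 [
    0b0100001010110101111000001, 0b1010001001000100101011010, 0b0111100010001010110011011,
    0b1010111011110011011111111, 0b0101011011001011001010100, 0b1101000101100001100111101,
    0b0100010101010110010001111, 0b0010001111111010000101000, 0b1000010100001011101100011,
    0b0111011100111100111110110, 0b1001100111111100001010011, 0b1011100001011111110000100,
    0b0000110010100110100110100, 0b0011110100100001011001000, 0b1100101110001101010101110,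
    0b1111111000010000000100001]

/-- The design with 16 rows and 26 columns. -/
def design_16_26 : Matrix (Fin 16) (Fin 26) ℤ :=
  signMatrix 16 26 [
    0b10000000010001101100000110, 0b10110010101110001101110010, 0b01111101111011000101001110,
    0b11011101010100100101110001, 0b10101111111000010110000000, 0b00010010001001000111011001,
    0b01000001111000011011110111, 0b01111001000101011000010000, 0b10011110010010011000011111,
    0b11110011011111111110101101, 0b01100110110111100010010011, 0b00011011100100100010101110,
    0b00001100100111011111100101, 0b11100110100001110001111100, 0b00100101001010101000101001,
    0b11001000001110110011001010]

/-- The design with 16 rows and 27 columns. -/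
def design_16_27 : Matrix (Fin 16) (Fin 27) ℤ :=
  signMatrix 16 27 [
    0b000101011100100110010010100, 0b011010010001000110110101110, 0b110111100111010011010110010,
    0b000010111110101111101100010, 0b000001100001111001000001110, 0b010000110101000000001010001,
    0b011111010010101001110000001, 0b101100010100011101011101000, 0b101010001001011111000010001,
    0b101011101000000000111011010, 0b110101011001111010101111011, 0b110000111010110101110111101,
    0b111101101111001100100100100, 0b111001000110100111001001111, 0b000110001010010000001100111,
    0b001110100111111010111011101]

/-- The design with 18 rows and 23 columns. -/
def design_18_23 : Matrix (Fin 18) (Fin 23) ℤ :=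
  signMatrix 18 23 [
    0b01101001010011110111110, 0b00001010110101010110001, 0b10100110010010011010100,
    0b01000010111110101011111, 0b10111101111100100011101, 0b00011111000011100000101,
    0b01010001011101011000100, 0b01110100100111101110000, 0b11011010100000111101100,
    0b11101111011100111100011, 0b11101000000110000001001, 0b11110011101011010010011,
    0b10010000011010100100010, 0b10011100001111011111111, 0b00100001100000001100111,
    0b10000101100101110001010, 0b00111110111001001001010, 0b01000111001000000111000]

/-- The design with 18 rows and 24 columns. -/
def design_18_24 : Matrix (Fin 18) (Fin 24) ℤ :=
  signMatrix 18 24 [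
    0b101101001100001111000101, 0b000000011111101100110001, 0b101001110001000101100010,
    0b011111000110001001111000, 0b011110010100110101010111, 0b010000110111011111001100,
    0b111010101101100110111100, 0b100110111010100011010000, 0b000011101111010011110111,
    0b101010000011101001001111, 0b111001010010111010110110, 0b110111100001011100010001,
    0b100000000100010000011010, 0b010011011010000110001011, 0b010100101000001000100110,
    0b110101011001110001101101, 0b001100100010110110101001, 0b001111111101111010001010]

/-- The design with 18 rows and 25 columns. -/
def design_18_25 : Matrix (Fin 18) (Fin 25) ℤ :=
  signMatrix 18 25 [
    0b1101100011101100100001000, 0b1011011000001010000011101, 0b1001010101001111111111011,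
    0b1011001111110100110000111, 0b1000100100010110000111110, 0b1110010111011001010101100,
    0b0001110110111010111010100, 0b0110010101100010001000010, 0b0101111011010010101101111,
    0b0010111011000100011110000, 0b0101001001110011010110000, 0b0000001010101111011001110,
    0b0111100110000001010011011, 0b0110001100111100101111001, 0b1101111100100101001100101,
    0b0010100001101001100110111, 0b1110111000011111110000010, 0b1000000010010001101000001]

/-- The design with 18 rows and 26 columns. -/
def design_18_26 : Matrix (Fin 18) (Fin 26) ℤ :=
  signMatrix 18 26 [
    0b11001000000110111110100000, 0b00111111000110110110011001, 0b01011100111100001100111011,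
    0b11101101010001000100110101, 0b11010011011111110101111110, 0b01011101101000110011100100,
    0b10100110111010100000110000, 0b01000011100000000111010010, 0b10010000101011000110001101,
    0b01101011101111101000000111, 0b10111011011010001011100011, 0b00100001110101010010101010,
    0b00111000110011111101010110, 0b10010100000101100001000011, 0b11110010100100011001111101,
    0b01100110011001111111001001, 0b00000101010110001001001100, 0b10001110001001011010011110]

/-- The design with 18 rows and 27 columns. -/
def design_18_27 : Matrix (Fin 18) (Fin 27) ℤ :=
  signMatrix 18 27 [
    0b100010111001110110111010010, 0b111010100111001101000110010, 0b010101100001111111100110101,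
    0b001111000101101101111001011, 0b011000000011100010001011000, 0b001011110010110001011100001,
    0b100001010101000001010010100, 0b101001011011011011101101110, 0b100010001010101000100000101,
    0b110001100100010100001001111, 0b100100101110111011010011011, 0b010111011010010101100011000,
    0b110110110100100011101101100, 0b011111101000001010010000110, 0b011000111101011000110101001,
    0b000110010011000110010101111, 0b001100011100111100001110110, 0b111101001110000110111110001]

/-- The design with 18 rows and 28 columns. -/
def design_18_28 : Matrix (Fin 18) (Fin 28) ℤ :=
  signMatrix 18 28 [
    0b0101001101001110110001011111, 0b1110110000110110111100001111, 0b0001101100111011011100010010,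
    0b1001010000001001100101000101, 0b1010101011001001111001101010, 0b1101111010111100110011110001,
    0b0100000110111001101010101111, 0b0011001010000100011010000100, 0b0100110001010001011011011100,
    0b1010011100011110001111111100, 0b1110010111101101010110010010, 0b0011110101101010010010101001,
    0b0010100110010111100001010001, 0b0110001000100000100100111000, 0b1111011011010011000000110111,
    0b0000111111100100001101100111, 0b1001000011110010000111001010, 0b1101100101000111101110100000]

/-- The design with 18 rows and 29 columns. -/
def design_18_29 : Matrix (Fin 18) (Fin 29) ℤ :=
  signMatrix 18 29 [
    0b10110110000001110000011110001, 0b01010000111000011000000010000, 0b00001010010110100101010100000,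
    0b10011010010100010011101011111, 0b01111111010010011100101101010, 0b10000101111110110110111010010,
    0b11101011111111111000011001101, 0b11000010001010001110110111101, 0b01010101110011100001110111111,
    0b10001001100011011011000100011, 0b11110001000101111111110001000, 0b00101100011101101010100111011,
    0b00100011100000100010000001110, 0b11100001011101000101001110110, 0b11111100100110000100100000101,
    0b00111101001010001011011010100, 0b01001110101001110111101100100, 0b00010110101101001101011001011]

/-- The design with 20 rows and 21 columns. -/
def design_20_21 : Matrix (Fin 20) (Fin 21) ℤ :=
  signMatrix 20 21 [
    0b101001110101101000111, 0b000110010111001010000, 0b101111101011011110101,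
    0b001010111110000101001, 0b010000111011101111110, 0b111001000110100110100,
    0b000111100001100101100, 0b111110010000001101111, 0b111100110011110011001,
    0b001001000010011001010, 0b100111011110110011110, 0b110101101100001011000,
    0b110011001011000000011, 0b011101111101010100010, 0b011010001101111001100,
    0b010011110000010010101, 0b001100001000100010011, 0b010110100110111100011,
    0b100000011000111100000, 0b100000000101010111111]

/-- The design with 22 rows and 22 columns. -/
def design_22_22 : Matrix (Fin 22) (Fin 22) ℤ :=
  signMatrix 22 22 [
    0b0110100011001011011011, 0b0100000110110110010011, 0b1100001001011000100010,
    0b0010110001111100100111, 0b1010001110000001000111, 0b1010010101000010110100,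
    0b1111010100111011100011, 0b0001100100011001010100, 0b1100011101101101011001,
    0b0000111010101010000000, 0b0001010111000000101001, 0b1101111000000100010111,
    0b0111000000100100001100, 0b1110101110011110101101, 0b0001001011101111110101,
    0b1011100110101100111010, 0b0101101101100011101110, 0b1100110010110001111100,
    0b1001010011011111001110, 0b1011101001110010011001, 0b0010011000010111111010,
    0b0111111111010101000000]

/-- The design with 22 rows and 23 columns. -/
def design_22_23 : Matrix (Fin 22) (Fin 23) ℤ :=
  signMatrix 22 23 [
    0b01110101101101101101011, 0b11110011011001001000100, 0b01101011001010110100111,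
    0b00000000001110001101100, 0b00100111111010110011000, 0b01011110111110011000001,
    0b11000011010100111111001, 0b11110000010110110001010, 0b00111100001001010110000,
    0b10001010101001111001010, 0b01000101100000011010110, 0b01011110010011101111110,
    0b00110000110101110110100, 0b10101100011100101010111, 0b10101101110011011101101,
    0b00011001010000000001011, 0b01101010100101000011101, 0b10010111001111010011111,
    0b11001001111111000110010, 0b10011111100100100100100, 0b11000100000011100000001,
    0b10110010100010001110011]

/-- The design with 24 rows and 24 columns. -/
def design_24_24 : Matrix (Fin 24) (Fin 24) ℤ :=
  signMatrix 24 24 [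
    0b011110110101011101101111, 0b110100111000010010000101, 0b000010111110000101010100,
    0b011100000111100000100100, 0b111001010001001101000000, 0b100100001011010101111001,
    0b011001111010110001101010, 0b111001101101100100011111, 0b101111100010011000011100,
    0b111010011110001010111001, 0b001100101000001110110010, 0b011011000000110111110101,
    0b000010000000000000001011, 0b010000100101111011011000, 0b001111011101110110001000,
    0b100101010100000011111110, 0b001001001111011011000111, 0b000001110011101110101101,
    0b110011100111010110100010, 0b010101010110111100010011, 0b100111101100101001100001,
    0b101110110011100011010011, 0b100010011001111000110110, 0b110110001010101111001110]

/-- The design with 24 rows and 25 columns. -/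
def design_24_25 : Matrix (Fin 24) (Fin 25) ℤ :=
  signMatrix 24 25 [
    0b0010110011011010000100001, 0b0000111111110101111110011, 0b0111101000011111011101111,
    0b1110110101000010011011111, 0b0010011101001111110000100, 0b1010001011100001100101111,
    0b1001010010111011111011101, 0b1101011110010110000000111, 0b1100110000110100110101100,
    0b0100111010001000101001010, 0b1011100010100110111000010, 0b0111001110010010110111000,
    0b0111010100100001001100001, 0b1111011001111001010010010, 0b0010000100111100100011011,
    0b0001010001000111000111010, 0b0110000011010101001010100, 0b1000001000001100011110001,
    0b1011111111101100001111100, 0b1001000101011000101100110, 0b0100100110101011010110110,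
    0b1000101100110011001001000, 0b1101100111001101110001001, 0b0101101001100010100010101]

/-! Everything reduces to one inequality `S ≤ pairSum D'` for all SSDs of the given size, where `S`
is the sum attained by the listed matrix.

Write `T = DDᵀ`. The matrices `DᵀD` and `DDᵀ` have the same sum of squared entries, so it suffices
to bound `T`. Balanced columns make the rows of `T` sum to zero, and so do those of `U = T + qJ -
qN·I`, with `J` the all-ones matrix; `U` has constant diagonal `a = m - q(N-1)`. Since `m + q ≡ 2
(mod 4)`, the row sums of `D` modulo 4 split the rows into two classes such that off-diagonal
entries of `U` are `2` modulo 4 within a class and `0` modulo 4 across. Quadratic inequalities valid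
on these residues, combined with the zero row sums, bound `∑ U²` below in terms of the size `c` of
one class (`IsSSD.exists_pairSum_ge`). As `c` is unknown, every admissible value is checked; the
congruence of `pairSum` modulo 16 or 32 then rounds the bound up to `S` (`IsSSD.le_pairSum`).

Minimax optimality follows from the same inequality: all `|s_ij|` agree modulo 4, so values below
`s` are at most `s - 4`, and few pairs at `s` would force a small sum. In each listed design only
`s` and, where it is nonnegative, `s - 4` can occur, so the two estimates meet. The rest is a finite
computation on binary words. -/

/-- The sum of `s_ij²` over `i < j`. -/
def pairSum {N m : ℕ} (D : Matrix (Fin N) (Fin m) ℤ) : ℤ :=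
  ∑ p ∈ columnPairs m, gram D p.1 p.2 ^ 2

/-! ### Sums over pairs of columns. -/

section PairSums

theorem card_columnPairs (m : ℕ) : (columnPairs m).card = m.choose 2 := by
  -- Count by the larger index: exactly `j` indices lie below `j`.
  have : (columnPairs m).card = ∑ j : Fin m, (j : ℕ) := by
    unfold columnPairs
    rw [Finset.card_filter, Fintype.sum_prod_type_right]
    refine Finset.sum_congr rfl fun j _ => ?_
    rw [← Finset.card_filter, Finset.filter_gt_eq_Iio, Fin.card_Iio]
  rw [this, Fin.sum_univ_eq_sum_range (fun i => i), Finset.sum_range_id, Nat.choose_two_right]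

/-- A sum of a symmetric function over all pairs, split into the diagonal and the pairs `i < j`. -/
theorem sum_sum_eq_columnPairs {m : ℕ} (f : Fin m → Fin m → ℤ) (hf : ∀ i j, f i j = f j i) :
    ∑ i, ∑ j, f i j = ∑ i, f i i + 2 * ∑ p ∈ columnPairs m, f p.1 p.2 := by
  have h : ∀ i j, f i j =
      (if i = j then f i j else 0) + (if i < j then f i j else 0) + (if j < i then f j i else 0) := by
    intro i j
    rcases lt_trichotomy i j with h | h | h
    · simp [h, h.ne, h.not_gt]
    · simp [h]
    · simp [h, h.ne', h.not_gt, hf i j]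
  have hP : ∑ p ∈ columnPairs m, f p.1 p.2 = ∑ i, ∑ j, if i < j then f i j else 0 := by
    unfold columnPairs
    rw [Finset.sum_filter, Fintype.sum_prod_type]
  rw [Finset.sum_congr rfl fun i _ => Finset.sum_congr rfl fun j _ => h i j]
  simp only [Finset.sum_add_distrib]
  rw [Finset.sum_comm (f := fun i j => if j < i then f j i else 0), ← hP]
  simp
  ring

theorem Es2_eq_pairSum {N m : ℕ} (D : Matrix (Fin N) (Fin m) ℤ) :
    Es2 D = (pairSum D : ℚ) / (m.choose 2 : ℚ) := by
  unfold Es2 pairSum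
  rw [← Finset.sum_div]
  push_cast
  rfl

end PairSums

/-! ### Inner products of sign vectors modulo 4. -/

section Congruences

variable {N m : ℕ} {D : Matrix (Fin N) (Fin m) ℤ}

theorem gram_apply (D : Matrix (Fin N) (Fin m) ℤ) (i j : Fin m) :
    gram D i j = ∑ k, D k i * D k j := by
  simp [gram, Matrix.mul_apply]

theorem gram_comm (D : Matrix (Fin N) (Fin m) ℤ) (i j : Fin m) : gram D i j = gram D j i := by
  simp only [gram_apply, mul_comm]

theorem sum_mul_self_of_sign {n : ℕ} {x : Fin n → ℤ} (hx : ∀ k, x k = 1 ∨ x k = -1) :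
    ∑ k, x k * x k = n := by
  have : ∀ k, x k * x k = 1 := fun k => by rcases hx k with h | h <;> simp [h]
  simp [this]

/-- Inner products of sign vectors modulo `4`. -/
theorem four_dvd_sum_mul {n : ℕ} {x y : Fin n → ℤ} (hx : ∀ k, x k = 1 ∨ x k = -1)
    (hy : ∀ k, y k = 1 ∨ y k = -1) :
    (4 : ℤ) ∣ ∑ k, x k * y k - (∑ k, x k + ∑ k, y k - n) := by
  -- Both factors `x k - 1` and `y k - 1` are `0` or `-2`, so each product is a multiple of 4.
  have : ∑ k, x k * y k - (∑ k, x k + ∑ k, y k - n) = ∑ k, (x k - 1) * (y k - 1) := by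
    have h : ∀ k, (x k - 1) * (y k - 1) = x k * y k - (x k + y k - 1) := fun k => by ring
    simp [h, Finset.sum_sub_distrib, Finset.sum_add_distrib]
  rw [this]
  refine Finset.dvd_sum fun k _ => ?_
  rcases hx k with h | h <;> rcases hy k with h' | h' <;> simp [h, h']

theorem two_dvd_sum_sub {n : ℕ} {x : Fin n → ℤ} (hx : ∀ k, x k = 1 ∨ x k = -1) :
    (2 : ℤ) ∣ ∑ k, x k - n := by
  have : ∑ k, x k - n = ∑ k, (x k - 1) := by simp
  rw [this]
  refine Finset.dvd_sum fun k _ => ?_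
  rcases hx k with h | h <;> simp [h]

theorem sum_col_eq_zero_iff (hD : ∀ i j, D i j = 1 ∨ D i j = -1) (j : Fin m) :
    ∑ i, D i j = 0 ↔ (Finset.univ.filter fun i => D i j = 1).card =
      (Finset.univ.filter fun i => D i j = -1).card := by
  have h : ∀ i, D i j = (if D i j = 1 then 1 else 0) - (if D i j = -1 then 1 else 0) := by
    intro i
    rcases hD i j with h | h <;> simp [h]
  rw [Finset.sum_congr rfl fun i _ => h i, Finset.sum_sub_distrib, Finset.sum_boole,
    Finset.sum_boole, sub_eq_zero]
  norm_cast

theorem IsSSD.sum_col (h : IsSSD D) (j : Fin m) : ∑ i, D i j = 0 :=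
  (sum_col_eq_zero_iff h.entries j).2 (h.balanced j)

theorem IsSSD.gram_self (h : IsSSD D) (j : Fin m) : gram D j j = N := by
  rw [gram_apply]
  exact sum_mul_self_of_sign fun k => h.entries k j

theorem IsSSD.four_dvd_gram_add (h : IsSSD D) (i j : Fin m) : (4 : ℤ) ∣ gram D i j + N := by
  have := four_dvd_sum_mul (fun k => h.entries k i) (fun k => h.entries k j)
  rwa [h.sum_col, h.sum_col, ← gram_apply, show gram D i j - (0 + 0 - (N : ℤ)) = gram D i j + N by
    ring] at this

end Congruences

/-! ### The lower bound on the sum of squares. -/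

section LowerBound

/-- Total of the squares of the entries of `DᵀD`, computed from `DDᵀ`. -/
theorem sum_sq_gram_eq {N m : ℕ} (D : Matrix (Fin N) (Fin m) ℤ) :
    ∑ i, ∑ j, gram D i j ^ 2 = ∑ k, ∑ l, (∑ j, D k j * D l j) ^ 2 := by
  have h1 : ∑ i, ∑ j, gram D i j ^ 2 = (gram D * gram D).trace := by
    simp only [Matrix.trace, Matrix.diag, Matrix.mul_apply (M := gram D)]
    refine Finset.sum_congr rfl fun i _ => Finset.sum_congr rfl fun j _ => ?_
    rw [gram_comm D j i, sq]
  have h2 : ∑ k, ∑ l, (∑ j, D k j * D l j) ^ 2 =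
      ((D * D.transpose) * (D * D.transpose)).trace := by
    simp only [Matrix.trace, Matrix.diag, Matrix.mul_apply (M := D * D.transpose)]
    refine Finset.sum_congr rfl fun k _ => Finset.sum_congr rfl fun l _ => ?_
    simp only [Matrix.mul_apply, Matrix.transpose_apply, sq]
    congr 1
    exact Finset.sum_congr rfl fun j _ => mul_comm _ _
  rw [h1, h2, gram]
  -- Cyclicity of the trace: `tr(DᵀDDᵀD) = tr(DDᵀDDᵀ)`.
  rw [Matrix.mul_assoc, Matrix.trace_mul_comm, Matrix.mul_assoc, Matrix.mul_assoc,
    ← Matrix.mul_assoc]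

/-- Let `U` be an integer matrix with constant diagonal `a`, whose off-diagonal entries are `2`
modulo `4` within each of two classes of indices (marked by `α = 0, 1`). The sum of squares is
bounded below by the sizes of the classes. -/
theorem sum_sq_ge_of_classes {N : ℕ} {U : Fin N → Fin N → ℤ} {α : Fin N → ℤ} {a : ℤ}
    (hα : ∀ k, α k = 0 ∨ α k = 1) (hdiag : ∀ k, U k k = a)
    (hU : ∀ k l, k ≠ l → α k = α l → U k l % 4 = 2) :
    N * a ^ 2 + 4 * (∑ k, α k) * (∑ k, α k - 1) + 4 * (N - ∑ k, α k) * (N - ∑ k, α k - 1) ≤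
      ∑ k, ∑ l, U k l ^ 2 := by
  -- The first two terms are `4` within a class and `0` across; the last corrects the diagonal from
  -- `4` to `a ^ 2`.
  have key : ∀ k l, 4 * (α k * α l) + 4 * ((1 - α k) * (1 - α l)) +
      (if k = l then a ^ 2 - 4 else 0) ≤ U k l ^ 2 := by
    intro k l
    by_cases hkl : k = l
    · subst hkl
      rw [hdiag]
      rcases hα k with h | h <;> simp [h]
    · simp only [hkl, if_false]
      have h4 : α k = α l → 4 ≤ U k l ^ 2 := by
        intro h
        have := hU k l hkl h
        have h2 : U k l ≤ -2 ∨ 2 ≤ U k l := by omega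
        rcases h2 with h2 | h2 <;> nlinarith
      rcases hα k with h | h <;> rcases hα l with h' | h' <;> simp [h, h'] at h4 ⊢ <;>
        nlinarith [sq_nonneg (U k l)]
  refine le_trans (le_of_eq ?_) (Finset.sum_le_sum fun k _ => Finset.sum_le_sum fun l _ => key k l)
  simp only [Finset.sum_add_distrib, ← Finset.mul_sum, ← Finset.sum_mul, Finset.sum_ite_eq,
    Finset.mem_univ, if_true, Finset.sum_sub_distrib, Finset.sum_const, Finset.card_univ,
    Fintype.card_fin, nsmul_eq_mul]
  ring

/-- A second bound, for symmetric `U` with zero row sums whose entries across the two classes are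
`0` modulo `4`. -/
theorem sum_sq_ge_of_classes_of_sum_eq_zero {N : ℕ} {U : Fin N → Fin N → ℤ} {α : Fin N → ℤ}
    {a : ℤ} (hα : ∀ k, α k = 0 ∨ α k = 1) (hdiag : ∀ k, U k k = a)
    (hsymm : ∀ k l, U k l = U l k) (hrow : ∀ k, ∑ l, U k l = 0)
    (hU : ∀ k l, k ≠ l → α k = α l → U k l % 4 = 2)
    (hU' : ∀ k l, k ≠ l → α k ≠ α l → U k l % 4 = 0) {σ : ℤ} (hσ : σ = 1 ∨ σ = -1) :
    N * a ^ 2 + 8 * (∑ k, α k) * (σ * a) - 12 * (∑ k, α k) * (∑ k, α k - 1) +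
        4 * (N - ∑ k, α k) * (N - ∑ k, α k - 1) ≤
      ∑ k, ∑ l, U k l ^ 2 := by
  -- Off the diagonal, with `u = U k l`, this says `(u + 4σ)² ≥ 4` inside the class `α = 1`, `u (u +
  -- 4σ) ≥ 0` across and `u² ≥ 4` inside `α = 0`. The residues modulo 4 make all three true. The
  -- diagonal term is chosen to give equality.
  have key : ∀ k l, (-4 * σ) * (α k * U k l) + (-4 * σ) * (α l * U l k) - 12 * (α k * α l) +
      4 * ((1 - α k) * (1 - α l)) +
      (if k = l then a ^ 2 - 4 + (8 * (σ * a) + 16) * α k else 0) ≤ U k l ^ 2 := by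
    intro k l
    rw [hsymm l k]
    by_cases hkl : k = l
    · subst hkl
      rw [hdiag]
      rcases hα k with h | h <;> simp [h]
      linarith
    · simp only [hkl, if_false]
      have h1 := hU k l hkl
      have h2 := hU' k l hkl
      generalize U k l = u at *
      rcases hα k with h | h <;> rcases hα l with h' | h' <;> simp [h, h'] at h1 h2 ⊢
      · have h2 : u ≤ -2 ∨ 2 ≤ u := by omega
        rcases h2 with h2 | h2 <;> nlinarith
      · have h3 : u ≤ -4 ∨ u = 0 ∨ 4 ≤ u := by omega
        rcases hσ with rfl | rfl <;> rcases h3 with h3 | h3 | h3 <;> nlinarith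
      · have h3 : u ≤ -4 ∨ u = 0 ∨ 4 ≤ u := by omega
        rcases hσ with rfl | rfl <;> rcases h3 with h3 | h3 | h3 <;> nlinarith
      · have h3 : u ≤ -6 ∨ u = -2 ∨ u = 2 ∨ 6 ≤ u := by omega
        rcases hσ with rfl | rfl <;> rcases h3 with h3 | h3 | h3 | h3 <;> nlinarith
  -- After summation the terms linear in `U` vanish, by the zero row sums; only the diagonal
  -- correction keeps a trace of `σ * a`.
  have hz : ∑ k, ∑ l, α k * U k l = 0 := by simp [← Finset.mul_sum, hrow]
  have hz' : ∑ k, ∑ l, α l * U l k = 0 := by rw [Finset.sum_comm]; exact hz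
  refine le_trans (le_of_eq ?_) (Finset.sum_le_sum fun k _ => Finset.sum_le_sum fun l _ => key k l)
  simp only [Finset.sum_add_distrib, Finset.sum_sub_distrib, ← Finset.mul_sum (a := -4 * σ)]
  rw [hz, hz']
  simp only [Finset.sum_add_distrib, ← Finset.mul_sum, ← Finset.sum_mul, Finset.sum_ite_eq,
    Finset.mem_univ, if_true, Finset.sum_sub_distrib, Finset.sum_const, Finset.card_univ,
    Fintype.card_fin, nsmul_eq_mul]
  ring

/-- Lower bound for `∑_{i ≠ j} s_ij²` in terms of the number `c` of rows in one of the two parity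
classes. -/
theorem IsSSD.exists_pairSum_ge {N m : ℕ} {D : Matrix (Fin N) (Fin m) ℤ} (h : IsSSD D) (q : ℕ)
    (hq : (m + q) % 4 = 2) {σ : ℤ} (hσ : σ = 1 ∨ σ = -1) :
    ∃ c ∈ Finset.range (N + 1), (N % 4 = 2 → (c + q) % 2 = 0) ∧
      ∀ g a d : ℤ, g = (m + q) ^ 2 * N - q ^ 2 * N ^ 2 - m * N ^ 2 → a = m - q * (N - 1) →
        d = N - c →
        g + 4 * c * (c - 1) + 4 * d * (d - 1) ≤ 2 * pairSum D ∧
        g + 8 * c * (σ * a) - 12 * c * (c - 1) + 4 * d * (d - 1) ≤ 2 * pairSum D ∧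
        g + 8 * d * (σ * a) - 12 * d * (d - 1) + 4 * c * (c - 1) ≤ 2 * pairSum D := by
  classical
  set R : Fin N → ℤ := fun k => ∑ j, D k j with hR
  set T : Fin N → Fin N → ℤ := fun k l => ∑ j, D k j * D l j with hT
  have hRm : ∀ k, (R k - m) % 4 = 0 ∨ (R k - m) % 4 = 2 := by
    intro k
    have := two_dvd_sum_sub (h.entries k)
    change (2 : ℤ) ∣ R k - m at this
    omega
  have hT4 : ∀ k l, (4 : ℤ) ∣ T k l - (R k + R l - m) := fun k l =>
    four_dvd_sum_mul (h.entries k) (h.entries l)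
  have hTdiag : ∀ k, T k k = m := fun k => sum_mul_self_of_sign (h.entries k)
  have hTsymm : ∀ k l, T k l = T l k := fun k l => by simp only [hT, mul_comm]
  have hTrow : ∀ k, ∑ l, T k l = 0 := by
    intro k
    simp only [hT]
    rw [Finset.sum_comm]
    simp [← Finset.mul_sum, h.sum_col]
  have hRsum : ∑ k, R k = 0 := by
    calc ∑ k, R k = ∑ j, ∑ k, D k j := Finset.sum_comm
      _ = 0 := by simp [h.sum_col]
  -- Each `R k` has the parity of `m`, so `R k` is `m` or `m + 2` modulo 4; `α` records which.
  set α : Fin N → ℤ := fun k => if (R k - m) % 4 = 2 then 1 else 0 with hαdef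
  have hα : ∀ k, α k = 0 ∨ α k = 1 := by
    intro k
    simp only [hαdef]
    split_ifs <;> simp
  have hαR : ∀ k, (R k - m - 2 * α k) % 4 = 0 := by
    intro k
    simp only [hαdef]
    have := hRm k
    split_ifs <;> omega
  set c := (Finset.univ.filter fun k => (R k - m) % 4 = 2).card with hc
  have hαc : ∑ k, α k = c := by
    simp only [hαdef]
    rw [Finset.sum_boole]
  have hcN : c ≤ N := by simpa using Finset.card_filter_le (Finset.univ : Finset (Fin N)) _
  refine ⟨c, Finset.mem_range.2 (by omega), ?_, ?_⟩
  · intro hN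
    -- The row sums total zero, so this reads `4 ∣ N m + 2 c` up to sign. For `N ≡ 2 (mod 4)` it
    -- makes `m + c` even, and `m + q` is even too.
    have h4 : (4 : ℤ) ∣ ∑ k, (R k - m - 2 * α k) :=
      Finset.dvd_sum fun k _ => Int.dvd_of_emod_eq_zero (hαR k)
    simp only [Finset.sum_sub_distrib, ← Finset.mul_sum, hRsum, hαc, Finset.sum_const,
      Finset.card_univ, Fintype.card_fin, nsmul_eq_mul] at h4
    obtain ⟨t, ht⟩ : ∃ t, N = 4 * t + 2 := ⟨N / 4, by omega⟩
    rw [ht] at h4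
    push_cast at h4
    have h5 : (4 : ℤ) ∣ 2 * m + 2 * c := by
      obtain ⟨u, hu⟩ := h4
      exact ⟨-u - t * m, by linear_combination -hu⟩
    omega
  · intro g a d hg ha hd
    -- Adding `q` moves the residues `m`, `m + 2` of `T` to `2`, `0`; subtracting `q N` on the
    -- diagonal restores zero row sums.
    set U : Fin N → Fin N → ℤ := fun k l => T k l + q - (if k = l then (q : ℤ) * N else 0) with hUdef
    have hUdiag : ∀ k, U k k = a := by
      intro k
      simp only [hUdef, hTdiag, if_true, ha]
      ring
    have hUsymm : ∀ k l, U k l = U l k := fun k l => by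
      simp only [hUdef, hTsymm k l, eq_comm]
    have hUrow : ∀ k, ∑ l, U k l = 0 := by
      intro k
      simp only [hUdef, Finset.sum_sub_distrib, Finset.sum_add_distrib, hTrow, Finset.sum_ite_eq,
        Finset.mem_univ, if_true, Finset.sum_const, Finset.card_univ, Fintype.card_fin,
        nsmul_eq_mul]
      linarith [mul_comm (q : ℤ) N]
    have hU2 : ∀ k l, k ≠ l → α k = α l → U k l % 4 = 2 := by
      intro k l hkl hα'
      have h1 := hT4 k l
      have h2 := hαR k
      have h3 := hαR l
      simp only [hUdef, hkl, if_false]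
      omega
    have hU0 : ∀ k l, k ≠ l → α k ≠ α l → U k l % 4 = 0 := by
      intro k l hkl hα'
      have h1 := hT4 k l
      have h2 := hαR k
      have h3 := hαR l
      have h4 := hα k
      have h5 := hα l
      simp only [hUdef, hkl, if_false]
      omega
    have hsum : ∑ k, ∑ l, U k l ^ 2 = 2 * pairSum D - g + N * a ^ 2 := by
      have h1 := sum_sq_gram_eq D
      rw [sum_sum_eq_columnPairs (fun i j => gram D i j ^ 2) (fun i j => by
        simp only [gram_comm D i j])] at h1
      simp only [h.gram_self, Finset.sum_const, Finset.card_univ, Fintype.card_fin,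
        nsmul_eq_mul] at h1
      change (m : ℤ) * N ^ 2 + 2 * pairSum D = ∑ k, ∑ l, T k l ^ 2 at h1
      have h2 : ∀ k l, U k l ^ 2 = T k l ^ 2 + 2 * q * T k l + q ^ 2 +
          (if k = l then (q * N : ℤ) ^ 2 - 2 * (q * N) * (T k l + q) else 0) := by
        intro k l
        simp only [hUdef]
        split_ifs <;> ring
      simp only [h2, Finset.sum_add_distrib, ← Finset.mul_sum, hTrow, Finset.sum_ite_eq,
        Finset.mem_univ, if_true, Finset.sum_const, Finset.card_univ, Fintype.card_fin,
        nsmul_eq_mul, hTdiag, ← h1, hg, ha]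
      ring
    have b0 := sum_sq_ge_of_classes hα hUdiag hU2
    have b1 := sum_sq_ge_of_classes_of_sum_eq_zero hα hUdiag hUsymm hUrow hU2 hU0 hσ
    -- The same bound with the two classes exchanged.
    have b2 := sum_sq_ge_of_classes_of_sum_eq_zero (α := fun k => 1 - α k)
      (fun k => by have := hα k; omega) hUdiag hUsymm hUrow
      (fun k l hkl hα' => hU2 k l hkl (by omega)) (fun k l hkl hα' => hU0 k l hkl (by omega)) hσ
    simp only [Finset.sum_sub_distrib, Finset.sum_const, Finset.card_univ, Fintype.card_fin,
      nsmul_eq_mul, mul_one, sub_sub_cancel] at b2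
    rw [hsum, hαc] at b0 b1 b2
    rw [← hd] at b0 b1 b2
    refine ⟨?_, ?_, ?_⟩ <;> linarith

/-- The lower bound for `∑_{i ≠ j} s_ij²` when one parity class has `c` rows. -/
def classBound (N m q c : ℤ) : ℤ :=
  (m + q) ^ 2 * N - q ^ 2 * N ^ 2 - m * N ^ 2 +
    max (4 * c * (c - 1) + 4 * (N - c) * (N - c - 1))
      (max (8 * c * |m - q * (N - 1)| - 12 * c * (c - 1) + 4 * (N - c) * (N - c - 1))
        (8 * (N - c) * |m - q * (N - 1)| - 12 * (N - c) * (N - c - 1) + 4 * c * (c - 1)))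

/-- If all admissible class sizes give more than `2 (S - n)`, and `pairSum D ≡ S (mod n)`, then
`S ≤ pairSum D`. -/
theorem IsSSD.le_pairSum {N m : ℕ} {D : Matrix (Fin N) (Fin m) ℤ} (h : IsSSD D) (q : ℕ)
    (hq : (m + q) % 4 = 2) {S n : ℤ} (hn : 0 < n) (hS : n ∣ pairSum D - S)
    (hc : ∀ c ∈ Finset.range (N + 1), (N % 4 = 2 → (c + q) % 2 = 0) →
      2 * (S - n) < classBound N m q c) : S ≤ pairSum D := by
  -- Taking `σ` to be the sign of the diagonal entry gives the stronger of the two choices, with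
  -- `|a|` in place of `σ * a`.
  obtain ⟨σ, hσ, hσa⟩ : ∃ σ : ℤ, (σ = 1 ∨ σ = -1) ∧
      σ * ((m : ℤ) - q * (N - 1)) = |(m : ℤ) - q * (N - 1)| := by
    rcases abs_choice ((m : ℤ) - q * (N - 1)) with h | h <;> rw [h]
    · exact ⟨1, by simp⟩
    · exact ⟨-1, by simp⟩
  obtain ⟨c, hcN, hpar, hb⟩ := h.exists_pairSum_ge q hq hσ
  obtain ⟨b0, b1, b2⟩ := hb _ _ _ rfl rfl rfl
  have hlt : 2 * (S - n) < 2 * pairSum D := by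
    refine (hc c hcN hpar).trans_le ?_
    rw [hσa] at b1 b2
    unfold classBound
    rw [← le_sub_iff_add_le']
    exact max_le (by linarith) (max_le (by linarith) (by linarith))
  obtain ⟨t, ht⟩ := hS
  -- Here `pairSum D = S + n t` exceeds `S - n`, so `t > -1`.
  have ht0 : 0 ≤ t := by
    by_contra hneg
    have : t ≤ -1 := by omega
    nlinarith
  nlinarith

theorem IsSSD.sixteen_dvd_pairSum {N m : ℕ} {D : Matrix (Fin N) (Fin m) ℤ} (h : IsSSD D)
    (hN : N % 4 = 0) : (16 : ℤ) ∣ pairSum D := by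
  refine Finset.dvd_sum fun p _ => ?_
  have h4 : (4 : ℤ) ∣ gram D p.1 p.2 := by
    have := h.four_dvd_gram_add p.1 p.2
    omega
  simpa using pow_dvd_pow_of_dvd h4 2

/-- For `x = 4t + 2` the difference is `16 t (t + 1)`, and `t (t + 1)` is even. -/
theorem thirtytwo_dvd_sq_sub_four {x : ℤ} (hx : x % 4 = 2) : (32 : ℤ) ∣ x ^ 2 - 4 := by
  obtain ⟨t, rfl⟩ : ∃ t, x = 4 * t + 2 := ⟨x / 4, by omega⟩
  obtain ⟨s, hs⟩ := (Int.even_mul_succ_self t).two_dvd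
  exact ⟨s, by linear_combination 16 * hs⟩

theorem IsSSD.gram_emod_four_of_two {N m : ℕ} {D : Matrix (Fin N) (Fin m) ℤ} (h : IsSSD D)
    (hN : N % 4 = 2) (i j : Fin m) : gram D i j % 4 = 2 := by
  have := h.four_dvd_gram_add i j
  omega

/-- Every `s_ij²` is `4` modulo 32. Doubled, this is the step of 64 behind the ceiling in
`rbBoundTwo`. -/
theorem IsSSD.thirtytwo_dvd_pairSum_sub {N m : ℕ} {D : Matrix (Fin N) (Fin m) ℤ} (h : IsSSD D)
    (hN : N % 4 = 2) : (32 : ℤ) ∣ pairSum D - 4 * m.choose 2 := by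
  have : pairSum D - 4 * m.choose 2 = ∑ p ∈ columnPairs m, (gram D p.1 p.2 ^ 2 - 4) := by
    rw [Finset.sum_sub_distrib, Finset.sum_const, card_columnPairs, pairSum, nsmul_eq_mul]
    ring
  rw [this]
  exact Finset.dvd_sum fun p _ => thirtytwo_dvd_sq_sub_four (h.gram_emod_four_of_two hN _ _)

theorem IsSSD.le_pairSum_of_four_dvd {N m : ℕ} {D : Matrix (Fin N) (Fin m) ℤ} (h : IsSSD D)
    (q : ℕ) (hN : N % 4 = 0) (hq : (m + q) % 4 = 2) {S : ℤ} (hS : (16 : ℤ) ∣ S)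
    (hc : ∀ c ∈ Finset.range (N + 1), (N % 4 = 2 → (c + q) % 2 = 0) →
      2 * (S - 16) < classBound N m q c) : S ≤ pairSum D :=
  h.le_pairSum q hq (by norm_num) ((h.sixteen_dvd_pairSum hN).sub hS) hc

theorem IsSSD.le_pairSum_of_mod_four_eq_two {N m : ℕ} {D : Matrix (Fin N) (Fin m) ℤ}
    (h : IsSSD D) (q : ℕ) (hN : N % 4 = 2) (hq : (m + q) % 4 = 2) {S : ℤ}
    (hS : (32 : ℤ) ∣ S - 4 * m.choose 2)
    (hc : ∀ c ∈ Finset.range (N + 1), (N % 4 = 2 → (c + q) % 2 = 0) →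
      2 * (S - 32) < classBound N m q c) : S ≤ pairSum D := by
  refine h.le_pairSum q hq (n := 32) (by norm_num) ?_ hc
  have := (h.thirtytwo_dvd_pairSum_sub hN).sub hS
  rwa [sub_sub_sub_cancel_right] at this

/-- No `s_ij` vanishes, being `2` modulo 4. This elementary bound suffices when the maximum in
`rbBoundTwo` is `0`. -/
theorem IsSSD.four_mul_choose_le_pairSum {N m : ℕ} {D : Matrix (Fin N) (Fin m) ℤ} (h : IsSSD D)
    (hN : N % 4 = 2) : 4 * (m.choose 2 : ℤ) ≤ pairSum D := by
  have : ∀ p ∈ columnPairs m, (4 : ℤ) ≤ gram D p.1 p.2 ^ 2 := by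
    intro p _
    have h1 := h.gram_emod_four_of_two hN p.1 p.2
    have h2 : gram D p.1 p.2 ≤ -2 ∨ 2 ≤ gram D p.1 p.2 := by omega
    rcases h2 with h2 | h2 <;> nlinarith
  have := Finset.card_nsmul_le_sum _ _ _ this
  rw [card_columnPairs, nsmul_eq_mul] at this
  rw [pairSum]
  linarith

end LowerBound

/-! ### From the sum of squares to minimax optimality. -/

section Minimax

variable {N m : ℕ} {D : Matrix (Fin N) (Fin m) ℤ}

theorem natAbs_gram_le_sMax (D : Matrix (Fin N) (Fin m) ℤ) {p : Fin m × Fin m}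
    (hp : p ∈ columnPairs m) : (gram D p.1 p.2).natAbs ≤ sMax D :=
  Finset.le_sup (f := fun p : Fin m × Fin m => (gram D p.1 p.2).natAbs) hp

/-- Upper bound for `∑_{i < j} s_ij²` when no `|s_ij|` exceeds `s`: all `|s_ij|` different from `s`
are at most `s - 4`. -/
theorem IsSSD.pairSum_le (h : IsSSD D) (hN : N % 2 = 0) {s : ℕ} (hs : s % 4 = N % 4)
    (hle : sMax D ≤ s) :
    pairSum D ≤ ((s - 4 : ℕ) : ℤ) ^ 2 * m.choose 2 + ((s : ℤ) ^ 2 - ((s - 4 : ℕ) : ℤ) ^ 2) *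
      ((columnPairs m).filter fun p => (gram D p.1 p.2).natAbs = s).card := by
  have key : ∀ p ∈ columnPairs m, gram D p.1 p.2 ^ 2 ≤ ((s - 4 : ℕ) : ℤ) ^ 2 +
      ((s : ℤ) ^ 2 - ((s - 4 : ℕ) : ℤ) ^ 2) *
        (if (gram D p.1 p.2).natAbs = s then 1 else 0) := by
    intro p hp
    have h1 := (natAbs_gram_le_sMax D hp).trans hle
    have h2 := h.four_dvd_gram_add p.1 p.2
    rw [← Int.natAbs_sq]
    split_ifs with hps
    · rw [hps]
      linarith
    -- For even `N`, `s_ij ≡ -N` gives `|s_ij| ≡ N ≡ s (mod 4)`. If `s < 4` no value below `s` is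
    -- possible, so the truncated `s - 4` is harmless.
    · have : (gram D p.1 p.2).natAbs ≤ s - 4 := by omega
      rw [mul_zero, add_zero]
      gcongr
  refine (Finset.sum_le_sum key).trans (le_of_eq ?_)
  rw [Finset.sum_add_distrib, ← Finset.mul_sum, Finset.sum_boole, Finset.sum_const,
    card_columnPairs, nsmul_eq_mul]
  ring

/-- A competitor with maximum at most `s` satisfies `IsSSD.pairSum_le`; against the lower bound `hS`
this forces at least `f` pairs with `|s_ij| = s`. Since `f > 0`, its maximum is then exactly `s`. -/
theorem isMinimaxOptimal_of_pairSum_le (h : IsSSD D) (hN : N % 2 = 0) {s f : ℕ}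
    (hs : s % 4 = N % 4) (hs0 : 0 < s) (hsD : sMax D = s) (hfD : freqSMax D = f) (hf : 0 < f)
    (hS : ∀ D' : Matrix (Fin N) (Fin m) ℤ, IsSSD D' →
      ((s - 4 : ℕ) : ℤ) ^ 2 * m.choose 2 + ((s : ℤ) ^ 2 - ((s - 4 : ℕ) : ℤ) ^ 2) * f ≤
        pairSum D') : IsMinimaxOptimal D := by
  refine ⟨h, fun D' hD' hlt => ?_⟩
  rw [hsD, hfD] at hlt
  have hlow := hS D' hD'
  have hup := hD'.pairSum_le hN hs (by omega)
  have hpos : (0 : ℤ) < (s : ℤ) ^ 2 - ((s - 4 : ℕ) : ℤ) ^ 2 := by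
    have : ((s - 4 : ℕ) : ℤ) < s := by omega
    nlinarith [Int.natCast_nonneg (s - 4)]
  have hcard : f ≤ ((columnPairs m).filter fun p => (gram D' p.1 p.2).natAbs = s).card := by
    have := le_of_mul_le_mul_left (le_of_add_le_add_left (hlow.trans hup)) hpos
    exact_mod_cast this
  rcases hlt with hlt | ⟨heq, hlt⟩
  · obtain ⟨p, hp⟩ := Finset.card_pos.1 (hf.trans_le hcard)
    rw [Finset.mem_filter] at hp
    have := natAbs_gram_le_sMax D' hp.1
    omega
  · rw [freqSMax, heq] at hlt
    omega

end Minimax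

/-! ### Evaluating a design from its binary words. -/

section Evaluation

/-- The sum of `f i` over `i < n`, by structural recursion. -/
def sumLT (f : ℕ → ℕ) : ℕ → ℕ
  | 0 => 0
  | n + 1 => sumLT f n + f n

theorem sumLT_eq (f : ℕ → ℕ) (n : ℕ) : sumLT f n = ∑ i ∈ Finset.range n, f i := by
  induction n with
  | zero => rfl
  | succ n ih => rw [sumLT, ih, Finset.sum_range_succ]

/-- The number of words in which the binary digits in positions `i` and `j` differ. -/
def disagreements (i j : ℕ) : List ℕ → ℕ
  | [] => 0
  | r :: rs => ((r >>> i) ^^^ (r >>> j)) % 2 + disagreements i j rs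

/-- The number of words whose binary digit in position `j` is `1`. -/
def ones (j : ℕ) : List ℕ → ℕ
  | [] => 0
  | r :: rs => (r >>> j) % 2 + ones j rs

/-- The sum of `g |s_ij|` over `i < j`, computed from the binary words of the rows. -/
def pairTotal (N m : ℕ) (rows : List ℕ) (g : ℕ → ℕ) : ℕ :=
  sumLT (fun j => sumLT (fun i => g ((N : ℤ) - 2 * (disagreements i j rows : ℕ)).natAbs) j) m

theorem shiftRight_mod_two (r i : ℕ) : (r >>> i) % 2 = if r.testBit i then 1 else 0 := by
  rw [Nat.testBit_eq_decide_div_mod_eq, Nat.shiftRight_eq_div_pow]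
  simp only [decide_eq_true_eq]
  split_ifs <;> omega

theorem xor_shiftRight_mod_two (r i j : ℕ) :
    ((r >>> i) ^^^ (r >>> j)) % 2 = if r.testBit i = r.testBit j then 0 else 1 := by
  have h := Nat.testBit_xor (r >>> i) (r >>> j) 0
  rw [Nat.testBit_zero, Nat.testBit_shiftRight, Nat.testBit_shiftRight, add_zero, add_zero] at h
  cases hi : r.testBit i <;> cases hj : r.testBit j <;> simp [hi, hj] at h ⊢ <;> omega

/-- A row contributes `1` if its two digits agree and `-1` if they differ. -/
theorem sum_getD_mul (rows : List ℕ) (i j : ℕ) :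
    ∑ k : Fin rows.length, (if (rows.getD k 0).testBit i then (1 : ℤ) else -1) *
      (if (rows.getD k 0).testBit j then 1 else -1) = rows.length - 2 * disagreements i j rows := by
  induction rows with
  | nil => simp [disagreements]
  | cons r rs ih =>
    rw [List.length_cons, Fin.sum_univ_succ]
    simp only [Fin.val_zero, Fin.val_succ, List.getD_cons_zero, List.getD_cons_succ]
    rw [ih, disagreements, xor_shiftRight_mod_two]
    cases r.testBit i <;> cases r.testBit j <;> push_cast <;> simp <;> ring

theorem sum_getD (rows : List ℕ) (j : ℕ) :
    ∑ k : Fin rows.length, (if (rows.getD k 0).testBit j then (1 : ℤ) else -1) =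
      2 * ones j rows - rows.length := by
  induction rows with
  | nil => simp [ones]
  | cons r rs ih =>
    rw [List.length_cons, Fin.sum_univ_succ]
    simp only [Fin.val_zero, Fin.val_succ, List.getD_cons_zero, List.getD_cons_succ]
    rw [ih, ones, shiftRight_mod_two]
    split_ifs <;> push_cast <;> ring

variable {N m : ℕ} {rows : List ℕ}

theorem gram_signMatrix (hN : rows.length = N) (i j : Fin m) :
    gram (signMatrix N m rows) i j =
      N - 2 * (disagreements (i.rev : ℕ) (j.rev : ℕ) rows : ℕ) := by
  subst hN
  rw [gram_apply]
  exact sum_getD_mul rows _ _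

theorem disagreements_comm (i j : ℕ) (rows : List ℕ) :
    disagreements i j rows = disagreements j i rows := by
  induction rows with
  | nil => rfl
  | cons r rs ih => rw [disagreements, disagreements, ih, Nat.xor_comm]

/-- Words are read from the left, so column `j` is bit `j.rev`. Reversal turns `i < j` into `j < i`,
which is absorbed by the symmetry of `disagreements`. -/
theorem sum_columnPairs_signMatrix (hN : rows.length = N) (g : ℕ → ℕ) :
    ∑ p ∈ columnPairs m, g (gram (signMatrix N m rows) p.1 p.2).natAbs = pairTotal N m rows g := by
  have h1 : pairTotal N m rows g = ∑ j : Fin m, ∑ i : Fin m,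
      if i < j then g ((N : ℤ) - 2 * (disagreements i j rows : ℕ)).natAbs else 0 := by
    rw [pairTotal, sumLT_eq, ← Fin.sum_univ_eq_sum_range]
    refine Finset.sum_congr rfl fun j _ => ?_
    simp only [Fin.lt_def]
    rw [sumLT_eq, Fin.sum_univ_eq_sum_range
      (fun i => if i < (j : ℕ) then g ((N : ℤ) - 2 * (disagreements i j rows : ℕ)).natAbs else 0) m,
      ← Finset.sum_filter]
    congr 1
    ext i
    simp only [Finset.mem_range, Finset.mem_filter]
    omega
  rw [h1, columnPairs, Finset.sum_filter, Fintype.sum_prod_type, ← Equiv.sum_comp Fin.revPerm]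
  refine Finset.sum_congr rfl fun j _ => ?_
  rw [← Equiv.sum_comp Fin.revPerm]
  refine Finset.sum_congr rfl fun i _ => ?_
  simp only [Fin.revPerm_apply, gram_signMatrix hN, Fin.rev_rev, Fin.rev_lt_rev,
    disagreements_comm j i]

/-- Equal or opposite columns would have inner product `±N`, so `|s_ij| ≤ s < N` already excludes
them. -/
theorem isSSD_signMatrix (hNm : N ≤ m) (hN : rows.length = N) {s : ℕ} (hs : s < N)
    (hones : sumLT (fun j => if 2 * ones j rows = N then 0 else 1) m = 0)
    (hle : pairTotal N m rows (fun x => if x ≤ s then 0 else 1) = 0) :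
    IsSSD (signMatrix N m rows) ∧
      ∀ p ∈ columnPairs m, (gram (signMatrix N m rows) p.1 p.2).natAbs ≤ s := by
  have hent : ∀ i j, signMatrix N m rows i j = 1 ∨ signMatrix N m rows i j = -1 := by
    intro i j
    simp only [signMatrix, Matrix.of_apply]
    split_ifs <;> simp
  have hbound : ∀ p ∈ columnPairs m, (gram (signMatrix N m rows) p.1 p.2).natAbs ≤ s := by
    intro p hp
    rw [← sum_columnPairs_signMatrix hN, Finset.sum_eq_zero_iff] at hle
    simpa using hle p hp
  have hbound' : ∀ i j, i ≠ j → (gram (signMatrix N m rows) i j).natAbs ≤ s := by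
    intro i j hij
    rcases lt_or_gt_of_ne hij with h | h
    · exact hbound (i, j) (by simpa [columnPairs] using h)
    · rw [gram_comm]
      exact hbound (j, i) (by simpa [columnPairs] using h)
  have hself : ∀ j, gram (signMatrix N m rows) j j = N := fun j => by
    rw [gram_apply]
    exact sum_mul_self_of_sign fun k => hent k j
  refine ⟨⟨hNm, hent, fun j => (sum_col_eq_zero_iff hent j).1 ?_, fun j k hjk heq => ?_,
    fun j k hjk heq => ?_⟩, hbound⟩
  · rw [sumLT_eq, Finset.sum_eq_zero_iff] at hones
    have h2 : 2 * ones (j.rev : ℕ) rows = N := by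
      simpa using hones _ (Finset.mem_range.2 j.rev.isLt)
    subst hN
    refine (sum_getD rows (j.rev : ℕ)).trans ?_
    omega
  · have h1 := hbound' j k hjk
    have h2 : gram (signMatrix N m rows) j k = N := by
      rw [← hself k, gram_apply, gram_apply]
      exact Finset.sum_congr rfl fun i _ => congrArg (· * _) (congrFun heq i)
    omega
  · have h1 := hbound' j k hjk
    have h2 : gram (signMatrix N m rows) j k = -N := by
      rw [← hself k, gram_apply, gram_apply, ← Finset.sum_neg_distrib]
      refine Finset.sum_congr rfl fun i _ => ?_
      rw [← neg_mul]
      exact congrArg (· * _) (congrFun heq i)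
    omega

/-- Certificate for an optimal design: the finitely many evaluations needed, together with a lower
bound for `∑_{i < j} s_ij²` over all designs of the same size. -/
theorem isOptimalDesign_signMatrix {s f q S : ℕ} {e : ℚ} (hNm : N ≤ m) (hN : rows.length = N)
    (hs : s < N) (hs0 : 0 < s) (hf : 0 < f) (hN2 : N % 2 = 0) (hsN : s % 4 = N % 4)
    (hones : sumLT (fun j => if 2 * ones j rows = N then 0 else 1) m = 0)
    (hle : pairTotal N m rows (fun x => if x ≤ s then 0 else 1) = 0)
    (hfreq : pairTotal N m rows (fun x => if x = s then 1 else 0) = f)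
    (hsum : pairTotal N m rows (fun x => x ^ 2) = S)
    (hS : (s - 4) ^ 2 * m.choose 2 + (s ^ 2 - (s - 4) ^ 2) * f = S)
    (he : (S : ℚ) / (m.choose 2 : ℚ) = e)
    (hq : ∀ q' : ℕ, IsRBIndex N m q' ↔ q' = q) (hb : rbBound N m q = e)
    (hlow : ∀ D : Matrix (Fin N) (Fin m) ℤ, IsSSD D → (S : ℤ) ≤ pairSum D) :
    IsOptimalDesign (signMatrix N m rows) s f e := by
  obtain ⟨hSSD, hbound⟩ := isSSD_signMatrix hNm hN hs hones hle
  have hcard : ((columnPairs m).filter fun p =>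
      (gram (signMatrix N m rows) p.1 p.2).natAbs = s).card = f := by
    rw [Finset.card_filter, ← hfreq, ← sum_columnPairs_signMatrix hN]
  have hpair : pairSum (signMatrix N m rows) = S := by
    rw [← hsum, ← sum_columnPairs_signMatrix hN, pairSum]
    push_cast
    simp only [sq_abs]
  have hmax : sMax (signMatrix N m rows) = s := by
    refine le_antisymm (Finset.sup_le hbound) ?_
    obtain ⟨p, hp⟩ := Finset.card_pos.1 (hf.trans_eq hcard.symm)
    rw [Finset.mem_filter] at hp
    exact hp.2 ▸ natAbs_gram_le_sMax _ hp.1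
  have hfr : freqSMax (signMatrix N m rows) = f := by rw [freqSMax, hmax, hcard]
  have hes : Es2 (signMatrix N m rows) = e := by rw [Es2_eq_pairSum, hpair, ← he]; rfl
  refine ⟨hSSD, hmax, hfr, hes, ⟨q, hq, hes.trans hb.symm⟩, ⟨hSSD, fun D' hD' => ?_⟩,
    isMinimaxOptimal_of_pairSum_le hSSD hN2 hsN hs0 hmax hfr hf fun D' hD' => ?_⟩
  · rw [not_lt, Es2_eq_pairSum, Es2_eq_pairSum, hpair]
    have : ((S : ℤ) : ℚ) ≤ pairSum D' := by exact_mod_cast hlow D' hD'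
    gcongr
  · refine le_trans (le_of_eq ?_) (hlow D' hD')
    -- Needed to cast the natural-number subtraction in `hS` to the integers.
    have : (s - 4) ^ 2 ≤ s ^ 2 := Nat.pow_le_pow_left (Nat.sub_le _ _) 2
    rw [← hS]
    push_cast [this]
    ring

end Evaluation

/-! ### The fifteen certificates. -/

section Designs

/-- Here `s = 4`, so `S = 16 f`. The range condition puts `q` in an open interval of length 4, where
the residue modulo 4 allows at most one value. -/
theorem isOptimalDesign_16_25 : IsOptimalDesign design_16_25 4 144 (192 / 25) :=
  isOptimalDesign_signMatrix (q := 1) (S := 2304) (by decide) rfl (by decide) (by decide)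
    (by decide) rfl rfl (by decide +kernel) (by decide +kernel) (by decide +kernel)
    (by decide +kernel) rfl (by decide +kernel) (fun q' => by unfold IsRBIndex; omega)
    (by decide +kernel) (hlow := fun _ h => h.le_pairSum_of_four_dvd 1 rfl rfl (by decide) (by decide +kernel))

theorem isOptimalDesign_16_26 : IsOptimalDesign design_16_26 4 160 (512 / 65) :=
  isOptimalDesign_signMatrix (q := 0) (S := 2560) (by decide) rfl (by decide) (by decide)
    (by decide) rfl rfl (by decide +kernel) (by decide +kernel) (by decide +kernel)
    (by decide +kernel) rfl (by decide +kernel) (fun q' => by unfold IsRBIndex; omega)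
    (by decide +kernel) (hlow := fun _ h => h.le_pairSum_of_four_dvd 0 rfl rfl (by decide) (by decide +kernel))

theorem isOptimalDesign_16_27 : IsOptimalDesign design_16_27 4 184 (2944 / 351) :=
  isOptimalDesign_signMatrix (q := 3) (S := 2944) (by decide) rfl (by decide) (by decide)
    (by decide) rfl rfl (by decide +kernel) (by decide +kernel) (by decide +kernel)
    (by decide +kernel) rfl (by decide +kernel) (fun q' => by unfold IsRBIndex; omega)
    (by decide +kernel) (hlow := fun _ h => h.le_pairSum_of_four_dvd 3 rfl rfl (by decide) (by decide +kernel))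

/-- Here `|s_ij|` is `2` or `6`, so `S = 4 * m.choose 2 + 32 f`. -/
theorem isOptimalDesign_18_23 : IsOptimalDesign design_18_23 6 17 (1556 / 253) :=
  isOptimalDesign_signMatrix (q := 3) (S := 1556) (by decide) rfl (by decide) (by decide)
    (by decide) rfl rfl (by decide +kernel) (by decide +kernel) (by decide +kernel)
    (by decide +kernel) rfl (by decide +kernel) (fun q' => by unfold IsRBIndex; omega)
    (by decide +kernel) (hlow := fun _ h => h.le_pairSum_of_mod_four_eq_two 3 rfl rfl (by decide) (by decide +kernel))

theorem isOptimalDesign_18_24 : IsOptimalDesign design_18_24 6 23 (20 / 3) :=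
  isOptimalDesign_signMatrix (q := 2) (S := 1840) (by decide) rfl (by decide) (by decide)
    (by decide) rfl rfl (by decide +kernel) (by decide +kernel) (by decide +kernel)
    (by decide +kernel) rfl (by decide +kernel) (fun q' => by unfold IsRBIndex; omega)
    (by decide +kernel) (hlow := fun _ h => h.le_pairSum_of_mod_four_eq_two 2 rfl rfl (by decide) (by decide +kernel))

theorem isOptimalDesign_18_25 : IsOptimalDesign design_18_25 6 30 (36 / 5) :=
  isOptimalDesign_signMatrix (q := 1) (S := 2160) (by decide) rfl (by decide) (by decide)
    (by decide) rfl rfl (by decide +kernel) (by decide +kernel) (by decide +kernel)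
    (by decide +kernel) rfl (by decide +kernel) (fun q' => by unfold IsRBIndex; omega)
    (by decide +kernel) (hlow := fun _ h => h.le_pairSum_of_mod_four_eq_two 1 rfl rfl (by decide) (by decide +kernel))

theorem isOptimalDesign_18_26 : IsOptimalDesign design_18_26 6 37 (2484 / 325) :=
  isOptimalDesign_signMatrix (q := 0) (S := 2484) (by decide) rfl (by decide) (by decide)
    (by decide) rfl rfl (by decide +kernel) (by decide +kernel) (by decide +kernel)
    (by decide +kernel) rfl (by decide +kernel) (fun q' => by unfold IsRBIndex; omega)
    (by decide +kernel) (hlow := fun _ h => h.le_pairSum_of_mod_four_eq_two 0 rfl rfl (by decide) (by decide +kernel))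

theorem isOptimalDesign_18_27 : IsOptimalDesign design_18_27 6 45 (316 / 39) :=
  isOptimalDesign_signMatrix (q := 3) (S := 2844) (by decide) rfl (by decide) (by decide)
    (by decide) rfl rfl (by decide +kernel) (by decide +kernel) (by decide +kernel)
    (by decide +kernel) rfl (by decide +kernel) (fun q' => by unfold IsRBIndex; omega)
    (by decide +kernel) (hlow := fun _ h => h.le_pairSum_of_mod_four_eq_two 3 rfl rfl (by decide) (by decide +kernel))

theorem isOptimalDesign_18_28 : IsOptimalDesign design_18_28 6 53 (1604 / 189) :=
  isOptimalDesign_signMatrix (q := 2) (S := 3208) (by decide) rfl (by decide) (by decide)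
    (by decide) rfl rfl (by decide +kernel) (by decide +kernel) (by decide +kernel)
    (by decide +kernel) rfl (by decide +kernel) (fun q' => by unfold IsRBIndex; omega)
    (by decide +kernel) (hlow := fun _ h => h.le_pairSum_of_mod_four_eq_two 2 rfl rfl (by decide) (by decide +kernel))

theorem isOptimalDesign_18_29 : IsOptimalDesign design_18_29 6 60 (1772 / 203) :=
  isOptimalDesign_signMatrix (q := 1) (S := 3544) (by decide) rfl (by decide) (by decide)
    (by decide) rfl rfl (by decide +kernel) (by decide +kernel) (by decide +kernel)
    (by decide +kernel) rfl (by decide +kernel) (fun q' => by unfold IsRBIndex; omega)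
    (by decide +kernel) (hlow := fun _ h => h.le_pairSum_of_mod_four_eq_two 1 rfl rfl (by decide) (by decide +kernel))

theorem isOptimalDesign_20_21 : IsOptimalDesign design_20_21 4 50 (80 / 21) :=
  isOptimalDesign_signMatrix (q := 1) (S := 800) (by decide) rfl (by decide) (by decide)
    (by decide) rfl rfl (by decide +kernel) (by decide +kernel) (by decide +kernel)
    (by decide +kernel) rfl (by decide +kernel) (fun q' => by unfold IsRBIndex; omega)
    (by decide +kernel) (hlow := fun _ h => h.le_pairSum_of_four_dvd 1 rfl rfl (by decide) (by decide +kernel))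

/-- All `|s_ij|` equal `2`, the least possible value, so no class sizes are needed. -/
theorem isOptimalDesign_22_22 : IsOptimalDesign design_22_22 2 231 4 :=
  isOptimalDesign_signMatrix (q := 0) (S := 924) (by decide) rfl (by decide) (by decide)
    (by decide) rfl rfl (by decide +kernel) (by decide +kernel) (by decide +kernel)
    (by decide +kernel) rfl (by decide +kernel) (fun q' => by unfold IsRBIndex; omega)
    (by decide +kernel) (hlow := fun _ h => h.four_mul_choose_le_pairSum rfl)

theorem isOptimalDesign_22_23 : IsOptimalDesign design_22_23 2 253 4 :=
  isOptimalDesign_signMatrix (q := 3) (S := 1012) (by decide) rfl (by decide) (by decide)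
    (by decide) rfl rfl (by decide +kernel) (by decide +kernel) (by decide +kernel)
    (by decide +kernel) rfl (by decide +kernel) (fun q' => by unfold IsRBIndex; omega)
    (by decide +kernel) (hlow := fun _ h => h.four_mul_choose_le_pairSum rfl)

theorem isOptimalDesign_24_24 : IsOptimalDesign design_24_24 4 36 (48 / 23) :=
  isOptimalDesign_signMatrix (q := 2) (S := 576) (by decide) rfl (by decide) (by decide)
    (by decide) rfl rfl (by decide +kernel) (by decide +kernel) (by decide +kernel)
    (by decide +kernel) rfl (by decide +kernel) (fun q' => by unfold IsRBIndex; omega)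
    (by decide +kernel) (hlow := fun _ h => h.le_pairSum_of_four_dvd 2 rfl rfl (by decide) (by decide +kernel))

theorem isOptimalDesign_24_25 : IsOptimalDesign design_24_25 4 72 (96 / 25) :=
  isOptimalDesign_signMatrix (q := 1) (S := 1152) (by decide) rfl (by decide) (by decide)
    (by decide) rfl rfl (by decide +kernel) (by decide +kernel) (by decide +kernel)
    (by decide +kernel) rfl (by decide +kernel) (fun q' => by unfold IsRBIndex; omega)
    (by decide +kernel) (hlow := fun _ h => h.le_pairSum_of_four_dvd 1 rfl rfl (by decide) (by decide +kernel))

end Designs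

theorem mainTheorem3 :
    IsOptimalDesign design_16_25 4 144 (192 / 25) ∧
    IsOptimalDesign design_16_26 4 160 (512 / 65) ∧
    IsOptimalDesign design_16_27 4 184 (2944 / 351) ∧
    IsOptimalDesign design_18_23 6 17 (1556 / 253) ∧
    IsOptimalDesign design_18_24 6 23 (20 / 3) ∧
    IsOptimalDesign design_18_25 6 30 (36 / 5) ∧
    IsOptimalDesign design_18_26 6 37 (2484 / 325) ∧
    IsOptimalDesign design_18_27 6 45 (316 / 39) ∧
    IsOptimalDesign design_18_28 6 53 (1604 / 189) ∧
    IsOptimalDesign design_18_29 6 60 (1772 / 203) ∧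
    IsOptimalDesign design_20_21 4 50 (80 / 21) ∧
    IsOptimalDesign design_22_22 2 231 4 ∧
    IsOptimalDesign design_22_23 2 253 4 ∧
    IsOptimalDesign design_24_24 4 36 (48 / 23) ∧
    IsOptimalDesign design_24_25 4 72 (96 / 25) := by
  exact ⟨isOptimalDesign_16_25, isOptimalDesign_16_26, isOptimalDesign_16_27,
    isOptimalDesign_18_23, isOptimalDesign_18_24, isOptimalDesign_18_25, isOptimalDesign_18_26,
    isOptimalDesign_18_27, isOptimalDesign_18_28, isOptimalDesign_18_29, isOptimalDesign_20_21,
    isOptimalDesign_22_22, isOptimalDesign_22_23, isOptimalDesign_24_24, isOptimalDesign_24_25⟩
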